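/- **Floating-point model.** Let $\mathsf u>0$ be the unit roundoff. Every single real operation $\circ\in\{+,-,\times,/\}$ on real numbers returns a value $(x\circ y)(1+\delta)$ with an arbitrary $|\delta|\le\mathsf u$, and a run of an algorithm is any execution in this model (without division by zero). Sums may be evaluated in any order, and matrices are added and multiplied in the conventional way. The inverse of a real matrix $M\in\mathbb R^{n\times n}$ is computed via LU decomposition without interchanges: compute factors $L_M$ (unit lower triangular) and $U_M$ (upper triangular) by Gaussian elimination, compute $T\approx U_M^{-1}$ by solving $tU_M=e_i^{\mathsf T}$ by substitution for every row $t$ of $T$, and solve $V L_M=T$ by substitution for $V\approx M^{-1}$. For a real matrix $M$, $|M|$ is the matrix of absolute values of the entries; for a complex matrix it is the matrix of moduli; $\le$ between matrices is entrywise. **Algorithm (Frobenius inversion).** Let $Z=A+iB\in\mathrm{GL}_n(\mathbb C)$ with $A,B\in\mathbb R^{n\times n}$. Write $Z\in\mathcal S_1$ if $A$ and $A+BA^{-1}B$ are invertible, and $Z\in\mathcal S_2$ if $B$ and $B+AB^{-1}A$ are invertible. Put $(X,Y)=(A,B)$ if $Z\in\mathcal S_1$ and $(X,Y)=(B,A)$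 if $Z\in\mathcal S_2$ (if $Z$ lies in both sets, either choice is allowed). Compute, in this order, $X^{-1}$, $X^{-1}Y$, $Y(X^{-1}Y)$, $X+YX^{-1}Y$, $J=(X+YX^{-1}Y)^{-1}$, $K=(X^{-1}Y)J$, each step from the previously computed values, and return $J-iK$ in the first case and $K-iJ$ in the second. **Theorem.** There is an absolute constant $C>0$ with the following property. Let $n\ge 0$, let $Z\in\mathcal S_1\cup\mathcal S_2$, and let $X,Y$ be as above. Assume that $X$ and $X+YX^{-1}Y$ have (exact) LU decompositions with unit lower triangular first factor. Put $J=(X+YX^{-1}Y)^{-1}$ (exact). Then there are $\mathsf u_0>0$ and $\kappa\ge 0$, depending only on $n$, $Z$ and the choice of $(X,Y)$, such that for all $0<\mathsf u\le\mathsf u_0$ and every run of the algorithm on $Z$ with unit roundoff $\mathsf u$, with output $W$, computed value $P$ of $X+YX^{-1}Y$, computed LU factors $L_X,U_X$ of $X$ and $L_P,U_P$ of $P$, $$|Z^{-1}-W|\le C\,n\,\mathsf u\,\Big(|X^{-1}||L_X||U_X||X^{-1}||Y||J|+(|X^{-1}Y|+I)\,|J|\,\big(|X|+|Y||X^{-1}||L_X||U_X||X^{-1}||Y|+|L_P||U_P|\big)\,|J|\Big)+\kappa\,\mathsf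 u^2E,$$ where $E$ is the all-ones matrix. That is, the bound is $O(n)\,\mathsf u\,(\cdots)+O(\mathsf u^2)$. -/

import Mathlib

namespace FrobeniusInversion

/-! ### Floating-point arithmetic: the standard model with unit roundoff `u` -/

/-- `z` is an admissible computed value of a single arithmetic operation whose exact result is `x`:
`z = x (1 + δ)` with `|δ| ≤ u`. -/
def Fl (u x z : ℝ) : Prop := ∃ δ : ℝ, |δ| ≤ u ∧ z = x * (1 + δ)

/-- `z` is a computed value of the quotient `x / y`; there is none when `y = 0` (breakdown). -/
def FlDiv (u x y z : ℝ) : Prop := y ≠ 0 ∧ Fl u (x / y) z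

/-- `FlSum u s z`: `z` is a computed value of the sum of the (nonempty) multiset `s` of numbers,
added up by rounded binary additions in an arbitrary order and with arbitrary parentheses. -/
inductive FlSum (u : ℝ) : Multiset ℝ → ℝ → Prop
  | single (a : ℝ) : FlSum u {a} a
  | add {s t : Multiset ℝ} {x y z : ℝ} :
      FlSum u s x → FlSum u t y → Fl u (x + y) z → FlSum u (s + t) z

/-- `z` is a computed value of `∑ k ∈ s, a k * b k`. -/
def FlDot {n : ℕ} (u : ℝ) (s : Finset (Fin n)) (a b : Fin n → ℝ) (z : ℝ) : Prop :=
  ∃ p : Fin n → ℝ, (∀ k ∈ s, Fl u (a k * b k) (p k)) ∧ FlSum u (s.val.map p) z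

/-- `z` is a computed value of `c - ∑ k ∈ s, a k * b k`. -/
def FlSubDot {n : ℕ} (u c : ℝ) (s : Finset (Fin n)) (a b : Fin n → ℝ) (z : ℝ) : Prop :=
  ∃ p : Fin n → ℝ, (∀ k ∈ s, Fl u (a k * b k) (p k)) ∧
    FlSum u (c ::ₘ s.val.map (fun k => -p k)) z

/-! ### Real matrix operations in floating-point arithmetic -/

/-- `S` is a computed value of the sum `A + B`. -/
def FlMatAdd {n : ℕ} (u : ℝ) (A B S : Matrix (Fin n) (Fin n) ℝ) : Prop :=
  ∀ i j, Fl u (A i j + B i j) (S i j)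

/-- `C` is a computed value of the product `A * B` (conventional matrix multiplication). -/
def FlMatMul {n : ℕ} (u : ℝ) (A B C : Matrix (Fin n) (Fin n) ℝ) : Prop :=
  ∀ i j, FlDot u Finset.univ (fun k => A i k) (fun k => B k j) (C i j)

/-- `L` is unit lower triangular. -/
def IsUnitLower {n : ℕ} (L : Matrix (Fin n) (Fin n) ℝ) : Prop :=
  (∀ i, L i i = 1) ∧ ∀ i j, i < j → L i j = 0

/-- `U` is upper triangular. -/
def IsUpper {n : ℕ} (U : Matrix (Fin n) (Fin n) ℝ) : Prop :=
  ∀ i j, j < i → U i j = 0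

/-- `A` has an (exact) LU decomposition. -/
def HasLU {n : ℕ} (A : Matrix (Fin n) (Fin n) ℝ) : Prop :=
  ∃ L U : Matrix (Fin n) (Fin n) ℝ, IsUnitLower L ∧ IsUpper U ∧ A = L * U

/-- `L` and `U` are the computed factors of the LU decomposition of `A` (Gaussian elimination
without interchanges; the sums may be formed in any order, so that all the loop orderings of the
elimination are covered). -/
structure FlLU {n : ℕ} (u : ℝ) (A L U : Matrix (Fin n) (Fin n) ℝ) : Prop where
  lower : IsUnitLower L
  upper : IsUpper U
  upper_entry : ∀ k j, k ≤ j →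
    FlSubDot u (A k j) (Finset.Iio k) (fun m => L k m) (fun m => U m j) (U k j)
  lower_entry : ∀ i k, k < i → ∃ s : ℝ,
    FlSubDot u (A i k) (Finset.Iio k) (fun m => L i m) (fun m => U m k) s ∧
      FlDiv u s (U k k) (L i k)

/-- `T` is the computed inverse of the upper triangular matrix `U`: every row `t` of `T` is obtained
from `t U = eᵢ` by forward substitution. -/
structure FlUpperInv {n : ℕ} (u : ℝ) (U T : Matrix (Fin n) (Fin n) ℝ) : Prop where
  upper : IsUpper T
  entry : ∀ i j, i ≤ j → ∃ s : ℝ,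
    FlSubDot u ((1 : Matrix (Fin n) (Fin n) ℝ) i j) (Finset.Ico i j)
      (fun k => T i k) (fun k => U k j) s ∧ FlDiv u s (U j j) (T i j)

/-- `V` is the solution of `V L = T`, with `L` unit lower triangular, computed by substitution. -/
def FlSolveLower {n : ℕ} (u : ℝ) (L T V : Matrix (Fin n) (Fin n) ℝ) : Prop :=
  ∀ i j, FlSubDot u (T i j) (Finset.Ioi j) (fun k => V i k) (fun k => L k j) (V i j)

/-- `V` is the inverse of `A` computed via LU decomposition, and `L`, `U` are the computed LU
factors: factor `A = L U`, compute `T = U⁻¹`, solve `V L = T` for `V`. -/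
def FlInverse {n : ℕ} (u : ℝ) (A L U V : Matrix (Fin n) (Fin n) ℝ) : Prop :=
  FlLU u A L U ∧ ∃ T : Matrix (Fin n) (Fin n) ℝ, FlUpperInv u U T ∧ FlSolveLower u L T V

/-! ### Frobenius inversion over `ℂ` -/

/-- The real part of a complex matrix. -/
def rePart {n : ℕ} (Z : Matrix (Fin n) (Fin n) ℂ) : Matrix (Fin n) (Fin n) ℝ := Z.map Complex.re

/-- The imaginary part of a complex matrix. -/
def imPart {n : ℕ} (Z : Matrix (Fin n) (Fin n) ℂ) : Matrix (Fin n) (Fin n) ℝ := Z.map Complex.im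

/-- The invertible `Z = A + iB` with `A` and `A + B A⁻¹ B` invertible. -/
def S₁ (n : ℕ) : Set (Matrix (Fin n) (Fin n) ℂ) :=
  {Z | IsUnit Z ∧ IsUnit (rePart Z) ∧ IsUnit (rePart Z + imPart Z * (rePart Z)⁻¹ * imPart Z)}

/-- The invertible `Z = A + iB` with `B` and `B + A B⁻¹ A` invertible. -/
def S₂ (n : ℕ) : Set (Matrix (Fin n) (Fin n) ℂ) :=
  {Z | IsUnit Z ∧ IsUnit (imPart Z) ∧ IsUnit (imPart Z + rePart Z * (imPart Z)⁻¹ * rePart Z)}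

/-- The complex matrix `R + i M`. -/
noncomputable def complexOf {n : ℕ} (R M : Matrix (Fin n) (Fin n) ℝ) :
    Matrix (Fin n) (Fin n) ℂ :=
  R.map (fun x : ℝ => (x : ℂ)) + Complex.I • M.map (fun x : ℝ => (x : ℂ))

/-- The two branches of the algorithm. -/
inductive Branch
  | first
  | second

/-- The inputs for which a branch may be taken. -/
def Branch.domain (b : Branch) (n : ℕ) : Set (Matrix (Fin n) (Fin n) ℂ) :=
  match b with
  | .first => S₁ n
  | .second => S₂ n

/-- `X = A` in the first branch and `X = B` in the second. -/
def Branch.X (b : Branch) {n : ℕ} (Z : Matrix (Fin n) (Fin n) ℂ) : Matrix (Fin n) (Fin n) ℝ :=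
  match b with
  | .first => rePart Z
  | .second => imPart Z

/-- `Y = B` in the first branch and `Y = A` in the second. -/
def Branch.Y (b : Branch) {n : ℕ} (Z : Matrix (Fin n) (Fin n) ℂ) : Matrix (Fin n) (Fin n) ℝ :=
  match b with
  | .first => imPart Z
  | .second => rePart Z

/-- The returned matrix: `J - iK` in the first branch and `K - iJ` in the second. -/
noncomputable def Branch.output (b : Branch) {n : ℕ} (J K : Matrix (Fin n) (Fin n) ℝ) :
    Matrix (Fin n) (Fin n) ℂ :=
  match b with
  | .first => complexOf J (-K)
  | .second => complexOf K (-J)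

/-- A run of Frobenius inversion on the input `Z`, along the branch `b`, in floating-point arithmetic
with unit roundoff `u`, that returns `W`. Here `LX`, `UX` and `LP`, `UP` are the LU factors computed
during the two real inversions and `P` is the computed value of `X + Y X⁻¹ Y`. -/
def FlFrobenius {n : ℕ} (u : ℝ) (b : Branch) (Z : Matrix (Fin n) (Fin n) ℂ)
    (LX UX P LP UP : Matrix (Fin n) (Fin n) ℝ) (W : Matrix (Fin n) (Fin n) ℂ) : Prop :=
  ∃ V H₁ H₂ J K : Matrix (Fin n) (Fin n) ℝ,
    FlInverse u (b.X Z) LX UX V ∧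
    FlMatMul u V (b.Y Z) H₁ ∧
    FlMatMul u (b.Y Z) H₁ H₂ ∧
    FlMatAdd u (b.X Z) H₂ P ∧
    FlInverse u P LP UP J ∧
    FlMatMul u H₁ J K ∧
    W = b.output J K

/-! ### The bound -/

/-- The entrywise absolute value of a real matrix. -/
def absM {n : ℕ} (A : Matrix (Fin n) (Fin n) ℝ) : Matrix (Fin n) (Fin n) ℝ := A.map (fun x => |x|)

/-- The exact matrix `J = (X + Y X⁻¹ Y)⁻¹`. -/
noncomputable def exactJ {n : ℕ} (X Y : Matrix (Fin n) (Fin n) ℝ) : Matrix (Fin n) (Fin n) ℝ :=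
  (X + Y * X⁻¹ * Y)⁻¹

/-- `|X⁻¹||L_X||U_X||X⁻¹||Y||J|
  + (|X⁻¹Y| + I)|J|(|X| + |Y||X⁻¹||L_X||U_X||X⁻¹||Y| + |L_P||U_P|)|J|`. -/
noncomputable def errorBound {n : ℕ} (X Y LX UX LP UP : Matrix (Fin n) (Fin n) ℝ) :
    Matrix (Fin n) (Fin n) ℝ :=
  absM X⁻¹ * absM LX * absM UX * absM X⁻¹ * absM Y * absM (exactJ X Y) +
    (absM (X⁻¹ * Y) + 1) * absM (exactJ X Y) *
      (absM X + absM Y * absM X⁻¹ * absM LX * absM UX * absM X⁻¹ * absM Y + absM LP * absM UP) *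
      absM (exactJ X Y)

end FrobeniusInversion

/-!
All residuals are relative to the exact operands, up to a factor `O(n u)`: a computed product `C`
of `A` and `B` satisfies `|C - AB| ≤ 8 n u |A||B|`, and the computed inverse `V` of `A` satisfies
`|VA - 1| ≤ 32 n u |V||L||U|`, the sum of the residuals of its three triangular stages.

A small residual is turned into a forward error by `V - S⁻¹ = (VP - 1) S⁻¹ - V (P - S) S⁻¹`, where
`P` is the computed value of `S`: this first shows `V = S⁻¹ + O(u)`, and then that `|V|` may be
replaced by `|S⁻¹|` in the first-order term. The computed LU factors stay bounded because they
converge to the exact ones. So every computed matrix has an error `≤ 8 n u G + O(u²)` with an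
explicit bounded `G`, and these `G` obey a product rule. They are all absorbed into the terms of the
theorem by `|X⁻¹| = |X⁻¹ X X⁻¹| ≤ |X⁻¹||L_X||U_X||X⁻¹| + O(u)`.
-/

namespace FrobeniusInversion

open Filter Topology Asymptotics
open scoped Matrix.Norms.Operator

section Scalar

variable {u : ℝ}

theorem Fl.abs_sub_le {x z : ℝ} (h : Fl u x z) : |z - x| ≤ u * |x| := by
  obtain ⟨δ, hδ, rfl⟩ := h
  calc |x * (1 + δ) - x| = |δ| * |x| := by rw [← abs_mul]; ring_nf
    _ ≤ u * |x| := by gcongr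

theorem abs_le_mul_of_abs_sub_le {c x y B : ℝ} (h : |x - y| ≤ (c - 1) * B) (hy : |y| ≤ B) :
    |x| ≤ c * B := by
  linarith [abs_sub_abs_le_abs_sub x y]

theorem Fl.abs_sub_le_of_abs_sub_le (hu : 0 ≤ u) {c x y z B : ℝ} (h : Fl u x z)
    (hxy : |x - y| ≤ (c - 1) * B) (hy : |y| ≤ B) :
    |z - y| ≤ (c * (1 + u) - 1) * B := by
  have hx : |x| ≤ c * B := abs_le_mul_of_abs_sub_le hxy hy
  calc |z - y| ≤ |z - x| + |x - y| := _root_.abs_sub_le z x y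
    _ ≤ u * (c * B) + (c - 1) * B := by
        gcongr
        exact h.abs_sub_le.trans (by gcongr)
    _ = (c * (1 + u) - 1) * B := by ring

theorem FlSum.card_pos {s : Multiset ℝ} {z : ℝ} (h : FlSum u s z) : 0 < s.card := by
  induction h with
  | single a => simp
  | add _ _ _ ihs _ => rw [Multiset.card_add]; omega

theorem FlSum.abs_sub_sum_le (hu : 0 ≤ u) {s : Multiset ℝ} {z : ℝ} (h : FlSum u s z) (k : ℕ)
    (hk : s.card ≤ k + 1) :
    |z - s.sum| ≤ ((1 + u) ^ k - 1) * (s.map (|·|)).sum := by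
  induction h generalizing k with
  | single a =>
    simpa using mul_nonneg (sub_nonneg.2 (one_le_pow₀ (by linarith))) (abs_nonneg a)
  | @add s t x y z hs ht hz ihs iht =>
    have hspos := hs.card_pos
    have htpos := ht.card_pos
    rw [Multiset.card_add] at hk
    obtain ⟨k, rfl⟩ := Nat.exists_eq_add_of_le' (show 1 ≤ k by omega)
    rw [Multiset.map_add, Multiset.sum_add, Multiset.sum_add, pow_succ]
    refine hz.abs_sub_le_of_abs_sub_le hu ?_
      ((abs_add_le _ _).trans (add_le_add Multiset.abs_sum_le_sum_abs Multiset.abs_sum_le_sum_abs))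
    calc |x + y - (s.sum + t.sum)| ≤ |x - s.sum| + |y - t.sum| := by
          rw [add_sub_add_comm]; exact abs_add_le _ _
      _ ≤ _ := by rw [mul_add]; exact add_le_add (ihs k (by omega)) (iht k (by omega))

theorem FlSum.abs_sub_sum_map_le {ι : Type*} (hu : 0 ≤ u) {m : Multiset ι} {x p : ι → ℝ} {z : ℝ}
    (h : FlSum u (m.map p) z) (hp : ∀ k ∈ m, |p k - x k| ≤ u * |x k|) :
    |z - (m.map x).sum| ≤ ((1 + u) ^ m.card - 1) * (m.map fun k => |x k|).sum := by
  have hpos := h.card_pos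
  rw [Multiset.card_map] at hpos
  obtain ⟨k, hk⟩ := Nat.exists_eq_add_of_le' hpos
  have hz : |z - (m.map p).sum| ≤ ((1 + u) ^ k - 1) * (m.map fun k => |p k|).sum := by
    simpa using h.abs_sub_sum_le hu k (by simp [hk])
  have hpx : |(m.map p).sum - (m.map x).sum| ≤ u * (m.map fun k => |x k|).sum := by
    rw [← Multiset.sum_map_sub, ← Multiset.sum_map_mul_left]
    refine Multiset.abs_sum_le_sum_abs.trans ?_
    rw [Multiset.map_map]
    exact Multiset.sum_map_le_sum_map _ _ hp
  have habs : (m.map fun k => |p k|).sum ≤ (1 + u) * (m.map fun k => |x k|).sum := by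
    rw [← Multiset.sum_map_mul_left]
    refine Multiset.sum_map_le_sum_map _ _ fun k hk => abs_le_mul_of_abs_sub_le ?_ le_rfl
    simpa using hp k hk
  have hpow : 0 ≤ (1 + u) ^ k - 1 := sub_nonneg.2 (one_le_pow₀ (by linarith))
  calc |z - (m.map x).sum|
      ≤ |z - (m.map p).sum| + |(m.map p).sum - (m.map x).sum| := _root_.abs_sub_le _ _ _
    _ ≤ ((1 + u) ^ k - 1) * ((1 + u) * (m.map fun k => |x k|).sum) +
        u * (m.map fun k => |x k|).sum := by
        gcongr
        exact hz.trans (by gcongr)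
    _ = _ := by rw [hk, pow_succ]; ring

theorem one_add_pow_sub_one_le {m : ℕ} (hu : 0 ≤ u) (hmu : m * u ≤ 1) :
    (1 + u) ^ m - 1 ≤ 2 * (m * u) := by
  have hnonneg : 0 ≤ m * u := by positivity
  calc (1 + u) ^ m - 1 ≤ Real.exp u ^ m - 1 := by
        gcongr; linarith [Real.add_one_le_exp u]
    _ ≤ |Real.exp (m * u) - 1| := by rw [Real.exp_nat_mul]; exact le_abs_self _
    _ ≤ 2 * |m * u| := Real.abs_exp_sub_one_le (by rwa [abs_of_nonneg hnonneg])
    _ = 2 * (m * u) := by rw [abs_of_nonneg hnonneg]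

variable {n : ℕ} {s : Finset (Fin n)} {a b : Fin n → ℝ}

theorem FlDot.abs_sub_le (hu : 0 ≤ u) (hnu : n * u ≤ 1) {z : ℝ} (h : FlDot u s a b z) :
    |z - ∑ k ∈ s, a k * b k| ≤ 2 * (n * u) * ∑ k ∈ s, |a k| * |b k| := by
  obtain ⟨p, hp, hz⟩ := h
  have hcard : (s.card : ℝ) * u ≤ n * u := by
    gcongr; exact s.card_le_univ.trans_eq (Fintype.card_fin n)
  calc |z - ∑ k ∈ s, a k * b k| ≤ ((1 + u) ^ s.card - 1) * ∑ k ∈ s, |a k * b k| :=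
        hz.abs_sub_sum_map_le hu fun k hk => (hp k hk).abs_sub_le
    _ ≤ 2 * (n * u) * ∑ k ∈ s, |a k * b k| := by
        gcongr; linarith [one_add_pow_sub_one_le hu (hcard.trans hnu)]
    _ = _ := by simp only [abs_mul]

theorem FlSubDot.abs_sub_le (hu : 0 ≤ u) (hnu : n * u ≤ 1) (hs : s.card < n) {c z : ℝ}
    (h : FlSubDot u c s a b z) :
    |z - (c - ∑ k ∈ s, a k * b k)| ≤ 2 * (n * u) * (|c| + ∑ k ∈ s, |a k| * |b k|) := by
  obtain ⟨p, hp, hz⟩ := h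
  -- The term `c` is carried by the index `none`; it is not rounded.
  let terms : Multiset (Option (Fin n)) := none ::ₘ s.val.map some
  have hterms (f : Option (Fin n) → ℝ) : (terms.map f).sum = f none + ∑ k ∈ s, f (some k) := by
    simp only [terms, Multiset.map_cons, Multiset.sum_cons, Multiset.map_map]; rfl
  have hz' : FlSum u (terms.map fun k => k.elim c fun k => -p k) z := by
    simpa [terms, Function.comp_def] using hz
  have herr := hz'.abs_sub_sum_map_le (x := fun k => k.elim c fun k => -(a k * b k)) hu <| by
    simp only [terms, Multiset.mem_cons, Multiset.mem_map, Finset.mem_val]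
    rintro _ (rfl | ⟨k, hk, rfl⟩)
    · simpa using mul_nonneg hu (abs_nonneg c)
    · simpa [neg_add_eq_sub, abs_sub_comm] using (hp k hk).abs_sub_le
  have hcard : ((terms.card : ℕ) : ℝ) * u ≤ n * u := by
    gcongr; simpa [terms] using hs
  simp only [hterms, Option.elim_none, Option.elim_some, abs_neg, abs_mul,
    Finset.sum_neg_distrib, ← sub_eq_add_neg] at herr
  refine herr.trans ?_
  gcongr
  linarith [one_add_pow_sub_one_le hu (hcard.trans hnu)]

theorem FlSubDot.abs_sub_sub_le (hu : 0 ≤ u) (hnu : 16 * (n * u) ≤ 1) (hs : s.card < n) {c z : ℝ}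
    (h : FlSubDot u c s a b z) :
    |c - ∑ k ∈ s, a k * b k - z| ≤ 5 * (n * u) * (|z| + ∑ k ∈ s, |a k| * |b k|) := by
  have hnonneg : 0 ≤ n * u := by positivity
  have herr := h.abs_sub_le hu (by linarith) hs
  have hdot : |∑ k ∈ s, a k * b k| ≤ ∑ k ∈ s, |a k| * |b k| := by
    simpa only [abs_mul] using Finset.abs_sum_le_sum_abs (fun k => a k * b k) s
  rw [abs_sub_comm] at herr
  set d := ∑ k ∈ s, a k * b k
  set D := ∑ k ∈ s, |a k| * |b k|
  set r := c - d - z with hr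
  have hc : |c| ≤ |r| + |d| + |z| := by
    rw [show c = r + d + z by rw [hr]; ring]; exact abs_add_three _ _ _
  have hself : |r| ≤ 2 * (n * u) * (|r| + |z| + 2 * D) :=
    herr.trans (mul_le_mul_of_nonneg_left (by linarith) (by positivity))
  have habsorb : 16 * (n * u) * |r| ≤ 1 * |r| := by gcongr
  have hD : 0 ≤ n * u * D := mul_nonneg hnonneg ((abs_nonneg _).trans hdot)
  have hz : 0 ≤ n * u * |z| := by positivity
  linarith

theorem FlDiv.abs_sub_mul_le (hu : u ≤ 1 / 2) {x y z : ℝ} (h : FlDiv u x y z) :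
    |x - z * y| ≤ 2 * u * (|z| * |y|) := by
  obtain ⟨hy, δ, hδ, rfl⟩ := h
  have hu0 : 0 ≤ u := (abs_nonneg δ).trans hδ
  have hδ' : 1 / 2 ≤ |1 + δ| := le_abs.2 (.inl (by linarith [neg_abs_le δ]))
  have hmul : x / y * (1 + δ) * y = x * (1 + δ) := by field_simp
  calc |x - x / y * (1 + δ) * y| = |x| * |δ| := by
        rw [hmul, ← abs_mul, ← abs_neg]; ring_nf
    _ ≤ |x| * (u * (2 * |1 + δ|)) := by
        gcongr
        exact hδ.trans (le_mul_of_one_le_right hu0 (by linarith))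
    _ = 2 * u * (|x / y * (1 + δ)| * |y|) := by rw [← abs_mul, hmul, abs_mul]; ring

theorem FlSubDot.abs_sub_sub_mul_le (hu : 0 ≤ u) (hnu : 16 * (n * u) ≤ 1) (hs : s.card < n)
    {c t y z : ℝ} (h : FlSubDot u c s a b t) (hdiv : FlDiv u t y z) :
    |c - ∑ k ∈ s, a k * b k - z * y| ≤
      8 * (n * u) * (|z| * |y| + ∑ k ∈ s, |a k| * |b k|) := by
  have hn : (1 : ℝ) ≤ n := by exact_mod_cast (Nat.zero_le _).trans_lt hs
  have hun : u ≤ n * u := le_mul_of_one_le_left hu hn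
  have hround := hdiv.abs_sub_mul_le (by linarith)
  have hD : 0 ≤ n * u * ∑ k ∈ s, |a k| * |b k| := by positivity
  have ht : |t| ≤ 9 / 8 * (|z| * |y|) := by
    refine abs_le_mul_of_abs_sub_le (hround.trans ?_) (abs_mul z y).le
    gcongr
    linarith
  calc |c - ∑ k ∈ s, a k * b k - z * y|
      ≤ |c - ∑ k ∈ s, a k * b k - t| + |t - z * y| := _root_.abs_sub_le _ _ _
    _ ≤ 5 * (n * u) * (9 / 8 * (|z| * |y|) + ∑ k ∈ s, |a k| * |b k|) +
        2 * (n * u) * (|z| * |y|) := by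
        gcongr
        · exact (h.abs_sub_sub_le hu hnu hs).trans (by gcongr)
        · exact hround.trans (by gcongr)
    _ ≤ _ := by linarith [show 0 ≤ n * u * (|z| * |y|) by positivity]

end Scalar

section EntrywiseOrder

variable {m n : Type*}

/-- The entrywise order on real matrices, in which the error bounds are stated. (Mathlib's order on
matrices is the Loewner order.) -/
scoped instance instPartialOrderMatrix : PartialOrder (Matrix m n ℝ) :=
  inferInstanceAs (PartialOrder (m → n → ℝ))

scoped instance instIsOrderedAddMonoidMatrix : IsOrderedAddMonoid (Matrix m n ℝ) :=
  inferInstanceAs (IsOrderedAddMonoid (m → n → ℝ))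

scoped instance instIsOrderedModuleMatrix : IsOrderedModule ℝ (Matrix m n ℝ) where
  smul_le_smul_of_nonneg_left _ hc _ _ hAB i j := mul_le_mul_of_nonneg_left (hAB i j) hc
  smul_le_smul_of_nonneg_right _ hA _ _ hcd i j := mul_le_mul_of_nonneg_right hcd (hA i j)

scoped instance instIsOrderedRingMatrix [Fintype n] [DecidableEq n] :
    IsOrderedRing (Matrix n n ℝ) where
  zero_le_one i j := by
    rw [Matrix.zero_apply, Matrix.one_apply]
    split_ifs <;> norm_num
  mul_le_mul_of_nonneg_left A hA B C hBC i j :=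
    Finset.sum_le_sum fun k _ => mul_le_mul_of_nonneg_left (hBC k j) (hA i k)
  mul_le_mul_of_nonneg_right A hA B C hBC i j :=
    Finset.sum_le_sum fun k _ => mul_le_mul_of_nonneg_right (hBC i k) (hA k j)

end EntrywiseOrder

section AbsM

variable {n : ℕ} (A B : Matrix (Fin n) (Fin n) ℝ)

theorem absM_nonneg : 0 ≤ absM A := fun i j => abs_nonneg (A i j)

theorem absM_neg : absM (-A) = absM A := by
  ext i j
  exact abs_neg (A i j)

theorem absM_add_le : absM (A + B) ≤ absM A + absM B := fun i j => abs_add_le (A i j) (B i j)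

theorem absM_sub_le : absM (A - B) ≤ absM A + absM B := fun i j => abs_sub (A i j) (B i j)

theorem absM_mul_le : absM (A * B) ≤ absM A * absM B := fun i j => by
  simpa only [Matrix.mul_apply, absM, Matrix.map_apply, abs_mul] using
    Finset.abs_sum_le_sum_abs (fun k => A i k * B k j) Finset.univ

theorem absM_absM_sub_absM_le : absM (absM A - absM B) ≤ absM (A - B) := fun i j =>
  abs_abs_sub_abs_le (A i j) (B i j)

variable {A B}

theorem abs_apply_le_norm (i j : Fin n) : |A i j| ≤ ‖A‖ := by
  rw [Matrix.linfty_opNorm_def]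
  have hrow : ∑ k, ‖A i k‖₊ ≤ Finset.univ.sup fun i => ∑ k, ‖A i k‖₊ :=
    Finset.le_sup (f := fun i => ∑ k, ‖A i k‖₊) (Finset.mem_univ i)
  have hentry : ‖A i j‖₊ ≤ ∑ k, ‖A i k‖₊ :=
    Finset.single_le_sum (f := fun k => ‖A i k‖₊) (fun _ _ => zero_le) (Finset.mem_univ j)
  exact_mod_cast hentry.trans hrow

theorem norm_le_norm_of_absM_le (h : absM A ≤ B) : ‖A‖ ≤ ‖B‖ := by
  rw [Matrix.linfty_opNorm_def, Matrix.linfty_opNorm_def]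
  refine NNReal.coe_le_coe.2 <| Finset.sup_mono_fun fun i _ => Finset.sum_le_sum fun j _ => ?_
  exact NNReal.coe_le_coe.1 ((h i j).trans (le_abs_self _))

theorem norm_absM : ‖absM A‖ = ‖A‖ := by
  simp [Matrix.linfty_opNorm_def, absM]

end AbsM

section Residual

variable {n : ℕ} {u : ℝ} {A B C L U T V : Matrix (Fin n) (Fin n) ℝ}

theorem mul_apply_eq_add_sum {i j a : Fin n} {s : Finset (Fin n)} (ha : a ∉ s)
    (h : ∀ k, k ≠ a → k ∉ s → A i k = 0 ∨ B k j = 0) :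
    (A * B) i j = A i a * B a j + ∑ k ∈ s, A i k * B k j := by
  rw [Matrix.mul_apply, ← Finset.sum_insert (f := fun k => A i k * B k j) ha]
  symm
  refine Finset.sum_subset (Finset.subset_univ _) fun k _ hk => ?_
  rw [Finset.mem_insert, not_or] at hk
  exact mul_eq_zero.2 (h k hk.1 hk.2)

theorem absM_mul_sub_apply_le {i j a : Fin n} {s : Finset (Fin n)} (ha : a ∉ s)
    (h : ∀ k, k ≠ a → k ∉ s → A i k = 0 ∨ B k j = 0) {γ : ℝ}
    (hres : |C i j - ∑ k ∈ s, A i k * B k j - A i a * B a j| ≤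
      γ * (|A i a| * |B a j| + ∑ k ∈ s, |A i k| * |B k j|)) :
    absM (A * B - C) i j ≤ (γ • (absM A * absM B)) i j := by
  have habs : (absM A * absM B) i j = |A i a| * |B a j| + ∑ k ∈ s, |A i k| * |B k j| :=
    mul_apply_eq_add_sum ha fun k hka hks => by simpa [absM] using h k hka hks
  rw [Matrix.smul_apply, smul_eq_mul, habs]
  refine le_of_eq_of_le ?_ hres
  change |(A * B - C) i j| = _
  rw [Matrix.sub_apply, mul_apply_eq_add_sum ha h, abs_sub_comm, sub_sub, add_comm]

theorem card_lt_of_notMem {a : Fin n} {s : Finset (Fin n)} (ha : a ∉ s) : s.card < n := by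
  simpa using Finset.card_lt_univ_of_notMem ha

theorem FlSubDot.absM_mul_sub_apply_le (hu : 0 ≤ u) (hnu : 16 * (n * u) ≤ 1) {i j a : Fin n}
    {s : Finset (Fin n)} (ha : a ∉ s) (h : ∀ k, k ≠ a → k ∉ s → A i k = 0 ∨ B k j = 0) {z : ℝ}
    (hz : FlSubDot u (C i j) s (fun k => A i k) (fun k => B k j) z)
    (hpivot : A i a * B a j = z) :
    absM (A * B - C) i j ≤ ((8 * (n * u)) • (absM A * absM B)) i j := by
  refine FrobeniusInversion.absM_mul_sub_apply_le ha h ?_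
  rw [← abs_mul, hpivot]
  refine (hz.abs_sub_sub_le hu hnu (card_lt_of_notMem ha)).trans ?_
  gcongr
  norm_num

theorem FlMatMul.absM_sub_le (hu : 0 ≤ u) (hnu : 16 * (n * u) ≤ 1) (h : FlMatMul u A B C) :
    absM (C - A * B) ≤ (8 * (n * u)) • (absM A * absM B) := fun i j => by
  refine ((h i j).abs_sub_le hu (by linarith)).trans ?_
  change _ ≤ 8 * (n * u) * ∑ k, |A i k| * |B k j|
  gcongr
  norm_num

theorem FlMatAdd.absM_sub_le (hu : 0 ≤ u) (h : FlMatAdd u A B C) :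
    absM (C - (A + B)) ≤ (8 * (n * u)) • absM (A + B) := fun i j => by
  have hn : (1 : ℝ) ≤ n := by exact_mod_cast i.pos
  refine (h i j).abs_sub_le.trans ?_
  change _ ≤ 8 * (n * u) * |A i j + B i j|
  gcongr
  nlinarith

theorem FlLU.absM_mul_sub_le (hu : 0 ≤ u) (hnu : 16 * (n * u) ≤ 1) (h : FlLU u A L U) :
    absM (L * U - A) ≤ (8 * (n * u)) • (absM L * absM U) := fun i j => by
  rcases le_or_gt i j with hij | hij
  · refine FlSubDot.absM_mul_sub_apply_le hu hnu (a := i) (by simp) (fun k hki hk => .inl ?_)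
      (h.upper_entry i j hij) (by rw [h.lower.1, one_mul])
    exact h.lower.2 i k (lt_of_le_of_ne (by simpa using hk) hki.symm)
  · obtain ⟨t, ht, hdiv⟩ := h.lower_entry i j hij
    have hj : j ∉ Finset.Iio j := by simp
    refine FrobeniusInversion.absM_mul_sub_apply_le hj (fun k hkj hk => .inr ?_)
      (ht.abs_sub_sub_mul_le hu hnu (card_lt_of_notMem hj) hdiv)
    exact h.upper k j (lt_of_le_of_ne (by simpa using hk) hkj.symm)

theorem FlUpperInv.absM_mul_sub_one_le (hu : 0 ≤ u) (hnu : 16 * (n * u) ≤ 1) (hU : IsUpper U)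
    (h : FlUpperInv u U T) :
    absM (T * U - 1) ≤ (8 * (n * u)) • (absM T * absM U) := fun i j => by
  have hj : j ∉ Finset.Ico i j := by simp
  have hzero (k : Fin n) (hkj : k ≠ j) (hk : k ∉ Finset.Ico i j) : T i k = 0 ∨ U k j = 0 := by
    rcases lt_or_ge k i with hki | hik
    · exact .inl (h.upper i k hki)
    · refine .inr (hU k j (lt_of_le_of_ne ?_ hkj.symm))
      simpa [hik] using hk
  rcases le_or_gt i j with hij | hij
  · obtain ⟨t, ht, hdiv⟩ := h.entry i j hij
    exact FrobeniusInversion.absM_mul_sub_apply_le hj hzero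
      (ht.abs_sub_sub_mul_le hu hnu (card_lt_of_notMem hj) hdiv)
  · refine FrobeniusInversion.absM_mul_sub_apply_le hj hzero (le_of_eq ?_)
    simp [Finset.Ico_eq_empty_of_le hij.le, h.upper i j hij, Matrix.one_apply_ne hij.ne']

theorem FlSolveLower.absM_mul_sub_le (hu : 0 ≤ u) (hnu : 16 * (n * u) ≤ 1) (hL : IsUnitLower L)
    (h : FlSolveLower u L T V) :
    absM (V * L - T) ≤ (8 * (n * u)) • (absM V * absM L) := fun i j => by
  refine FlSubDot.absM_mul_sub_apply_le hu hnu (a := j) (by simp) (fun k hkj hk => .inr ?_)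
    (h i j) (by rw [hL.1, mul_one])
  exact hL.2 k j (lt_of_le_of_ne (by simpa using hk) hkj)

theorem FlInverse.absM_mul_sub_one_le (hu : 0 ≤ u) (hnu : 16 * (n * u) ≤ 1)
    (h : FlInverse u A L U V) :
    absM (V * A - 1) ≤ (8 * (n * u)) • (absM V * (4 • (absM L * absM U))) := by
  obtain ⟨hLU, T, hT, hV⟩ := h
  have hfactor := hLU.absM_mul_sub_le hu hnu
  have hinv := hT.absM_mul_sub_one_le hu hnu hLU.upper
  have hsolve := hV.absM_mul_sub_le hu hnu hLU.lower
  have hLnonneg := absM_nonneg L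
  have hUnonneg := absM_nonneg U
  have hVnonneg := absM_nonneg V
  have hγ : 0 ≤ 8 * (n * u) := by positivity
  set γ := 8 * (n * u)
  have hTle : absM T ≤ 2 • (absM V * absM L) :=
    calc absM T = absM (V * L - (V * L - T)) := by rw [sub_sub_cancel]
      _ ≤ absM V * absM L + γ • (absM V * absM L) :=
          (absM_sub_le _ _).trans (add_le_add (absM_mul_le V L) hsolve)
      _ ≤ absM V * absM L + absM V * absM L := by
          gcongr
          exact smul_le_of_le_one_left (by positivity) (by linarith)
      _ = 2 • (absM V * absM L) := (two_smul ℕ _).symm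
  calc absM (V * A - 1) = absM (T * U - 1 + (V * L - T) * U - V * (L * U - A)) := by
        congr 1; noncomm_ring
    _ ≤ absM (T * U - 1) + absM (V * L - T) * absM U + absM V * absM (L * U - A) :=
        (absM_sub_le _ _).trans <| add_le_add
          ((absM_add_le _ _).trans (add_le_add le_rfl (absM_mul_le _ _))) (absM_mul_le _ _)
    _ ≤ γ • (2 • (absM V * absM L) * absM U) + γ • (absM V * absM L) * absM U +
        absM V * γ • (absM L * absM U) := by
        gcongr
        exact hinv.trans (by gcongr)
    _ = γ • (absM V * (4 • (absM L * absM U))) := by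
        simp only [smul_mul_assoc, mul_smul_comm, mul_assoc]
        module

end Residual

section Convergence

variable {Ω : Type*} {l : Filter Ω} {n : ℕ} {u : Ω → ℝ}

theorem eventually_mul_le_one (hu : Tendsto u l (𝓝 0)) (c : ℝ) : ∀ᶠ ω in l, c * u ω ≤ 1 :=
  Tendsto.eventually_le_const (by simp) (hu.const_mul c)

theorem tendsto_of_flDiv (hu : Tendsto u l (𝓝 0)) {x y z : Ω → ℝ} {x₀ y₀ : ℝ}
    (hx : Tendsto x l (𝓝 x₀)) (hy : Tendsto y l (𝓝 y₀)) (hy₀ : y₀ ≠ 0)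
    (h : ∀ ω, FlDiv (u ω) (x ω) (y ω) (z ω)) : Tendsto z l (𝓝 (x₀ / y₀)) := by
  have hexact : Tendsto (fun ω => x ω / y ω) l (𝓝 (x₀ / y₀)) := hx.div hy hy₀
  have hbound : Tendsto (fun ω => u ω * |x ω / y ω|) l (𝓝 0) := by
    simpa using hu.mul hexact.abs
  have herr : Tendsto (fun ω => z ω - x ω / y ω) l (𝓝 0) :=
    squeeze_zero_norm (fun ω => (h ω).2.abs_sub_le) hbound
  simpa using herr.add hexact

theorem tendsto_of_flSubDot (hu0 : ∀ ω, 0 ≤ u ω) (hu : Tendsto u l (𝓝 0)) {c z : Ω → ℝ}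
    {s : Finset (Fin n)} (hs : s.card < n) {a b : Ω → Fin n → ℝ} {c₀ : ℝ} {a₀ b₀ : Fin n → ℝ}
    (hc : Tendsto c l (𝓝 c₀)) (ha : ∀ k ∈ s, Tendsto (fun ω => a ω k) l (𝓝 (a₀ k)))
    (hb : ∀ k ∈ s, Tendsto (fun ω => b ω k) l (𝓝 (b₀ k)))
    (h : ∀ ω, FlSubDot (u ω) (c ω) s (a ω) (b ω) (z ω)) :
    Tendsto z l (𝓝 (c₀ - ∑ k ∈ s, a₀ k * b₀ k)) := by
  have hexact : Tendsto (fun ω => c ω - ∑ k ∈ s, a ω k * b ω k) l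
      (𝓝 (c₀ - ∑ k ∈ s, a₀ k * b₀ k)) :=
    hc.sub (tendsto_finsetSum _ fun k hk => (ha k hk).mul (hb k hk))
  have hbound : Tendsto (fun ω => 2 * (n * u ω) * (|c ω| + ∑ k ∈ s, |a ω k| * |b ω k|)) l
      (𝓝 0) := by
    simpa using ((hu.const_mul (n : ℝ)).const_mul 2).mul
      (hc.abs.add (tendsto_finsetSum s fun k hk => (ha k hk).abs.mul (hb k hk).abs))
  have herr : Tendsto (fun ω => z ω - (c ω - ∑ k ∈ s, a ω k * b ω k)) l (𝓝 0) := by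
    refine squeeze_zero_norm' ?_ hbound
    filter_upwards [eventually_mul_le_one hu n] with ω hω
    exact (h ω).abs_sub_le (hu0 ω) hω hs
  simpa using herr.add hexact

theorem IsUpper.diag_ne_zero {L U : Matrix (Fin n) (Fin n) ℝ} (hU : IsUpper U)
    (h : IsUnit (L * U)) (k : Fin n) : U k k ≠ 0 := by
  have hdet : IsUnit U.det := by
    rw [Matrix.isUnit_iff_isUnit_det, Matrix.det_mul] at h
    exact isUnit_of_mul_isUnit_right h
  rw [Matrix.det_of_isUpperTriangular (fun i j hij => hU i j hij)] at hdet
  exact Finset.prod_ne_zero_iff.1 hdet.ne_zero k (Finset.mem_univ k)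

variable {A L U : Ω → Matrix (Fin n) (Fin n) ℝ} {L₀ U₀ : Matrix (Fin n) (Fin n) ℝ}

theorem tendsto_upper_row_of_flLU (hu0 : ∀ ω, 0 ≤ u ω) (hu : Tendsto u l (𝓝 0))
    (hL₀ : IsUnitLower L₀) (hU₀ : IsUpper U₀)
    (hA : ∀ i j, Tendsto (fun ω => A ω i j) l (𝓝 ((L₀ * U₀) i j)))
    (h : ∀ ω, FlLU (u ω) (A ω) (L ω) (U ω)) (k : Fin n)
    (hL : ∀ m < k, ∀ i, Tendsto (fun ω => L ω i m) l (𝓝 (L₀ i m)))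
    (hU : ∀ m < k, ∀ j, Tendsto (fun ω => U ω m j) l (𝓝 (U₀ m j))) (j : Fin n) :
    Tendsto (fun ω => U ω k j) l (𝓝 (U₀ k j)) := by
  rcases lt_or_ge j k with hjk | hkj
  · simp only [fun ω => (h ω).upper k j hjk, hU₀ k j hjk, tendsto_const_nhds]
  · have hk : k ∉ Finset.Iio k := by simp
    have hlim := tendsto_of_flSubDot hu0 hu (card_lt_of_notMem hk) (hA k j)
      (fun m hm => hL m (Finset.mem_Iio.1 hm) k) (fun m hm => hU m (Finset.mem_Iio.1 hm) j)
      (fun ω => (h ω).upper_entry k j hkj)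
    rwa [mul_apply_eq_add_sum hk fun m hmk hm =>
      .inl (hL₀.2 k m (lt_of_le_of_ne (by simpa using hm) hmk.symm)),
      add_sub_cancel_right, hL₀.1, one_mul] at hlim

theorem tendsto_lower_col_of_flLU (hu0 : ∀ ω, 0 ≤ u ω) (hu : Tendsto u l (𝓝 0))
    (hL₀ : IsUnitLower L₀) (hU₀ : IsUpper U₀)
    (hA : ∀ i j, Tendsto (fun ω => A ω i j) l (𝓝 ((L₀ * U₀) i j)))
    (h : ∀ ω, FlLU (u ω) (A ω) (L ω) (U ω)) (k : Fin n) (hpivot : U₀ k k ≠ 0)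
    (hL : ∀ m < k, ∀ i, Tendsto (fun ω => L ω i m) l (𝓝 (L₀ i m)))
    (hU : ∀ m ≤ k, ∀ j, Tendsto (fun ω => U ω m j) l (𝓝 (U₀ m j))) (i : Fin n) :
    Tendsto (fun ω => L ω i k) l (𝓝 (L₀ i k)) := by
  rcases lt_trichotomy i k with hik | rfl | hki
  · simp only [fun ω => (h ω).lower.2 i k hik, hL₀.2 i k hik, tendsto_const_nhds]
  · simp only [fun ω => (h ω).lower.1 i, hL₀.1 i, tendsto_const_nhds]
  · choose t ht hdiv using fun ω => (h ω).lower_entry i k hki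
    have hk : k ∉ Finset.Iio k := by simp
    have hlim := tendsto_of_flSubDot hu0 hu (card_lt_of_notMem hk) (hA i k)
      (fun m hm => hL m (Finset.mem_Iio.1 hm) i) (fun m hm => hU m (Finset.mem_Iio.1 hm).le k) ht
    rw [mul_apply_eq_add_sum hk fun m hmk hm =>
      .inr (hU₀ m k (lt_of_le_of_ne (by simpa using hm) hmk.symm)), add_sub_cancel_right] at hlim
    simpa [hpivot] using tendsto_of_flDiv hu hlim (hU k le_rfl k) hpivot hdiv

theorem tendsto_of_flLU (hu0 : ∀ ω, 0 ≤ u ω) (hu : Tendsto u l (𝓝 0))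
    (hL₀ : IsUnitLower L₀) (hU₀ : IsUpper U₀) (hunit : IsUnit (L₀ * U₀))
    (hA : Tendsto A l (𝓝 (L₀ * U₀))) (h : ∀ ω, FlLU (u ω) (A ω) (L ω) (U ω)) :
    Tendsto L l (𝓝 L₀) ∧ Tendsto U l (𝓝 U₀) := by
  have hA' (i j : Fin n) : Tendsto (fun ω => A ω i j) l (𝓝 ((L₀ * U₀) i j)) :=
    (hA.apply_nhds i).apply_nhds j
  have hstep (k : Fin n) : (∀ i, Tendsto (fun ω => L ω i k) l (𝓝 (L₀ i k))) ∧
      ∀ j, Tendsto (fun ω => U ω k j) l (𝓝 (U₀ k j)) := by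
    induction k using WellFoundedLT.induction with
    | _ k ih =>
      have hrow := tendsto_upper_row_of_flLU hu0 hu hL₀ hU₀ hA' h k (fun m hm => (ih m hm).1)
        fun m hm => (ih m hm).2
      refine ⟨tendsto_lower_col_of_flLU hu0 hu hL₀ hU₀ hA' h k (hU₀.diag_ne_zero hunit k)
        (fun m hm => (ih m hm).1) fun m hm => ?_, hrow⟩
      rcases hm.lt_or_eq with hm | rfl
      exacts [(ih m hm).2, hrow]
  exact ⟨tendsto_pi_nhds.2 fun i => tendsto_pi_nhds.2 fun j => (hstep j).1 i,
    tendsto_pi_nhds.2 fun i => tendsto_pi_nhds.2 fun j => (hstep i).2 j⟩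

end Convergence

section NormedRing

variable {Ω E E' : Type*} [NormedRing E] [NormedAddCommGroup E'] {l : Filter Ω}

theorem isBigO_mul_const {F : Ω → E} {g : Ω → E'} (h : F =O[l] g) (c : E) :
    (fun ω => F ω * c) =O[l] g := by
  simpa using h.norm_right.mul (isBigO_const_const c (one_ne_zero (α := ℝ)) l)

theorem sub_isBigO_of_mul_sub_one_isBigO {V P : Ω → E} {S T : E} {e : Ω → ℝ}
    (he : Tendsto e l (𝓝 0)) (hST : S * T = 1) (hP : (fun ω => P ω - S) =O[l] e)
    (hV : (fun ω => V ω * P ω - 1) =O[l] fun ω => e ω * ‖V ω‖) :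
    (fun ω => V ω - T) =O[l] e := by
  have hres : (fun ω => V ω * S - 1) =O[l] fun ω => e ω * ‖V ω‖ := by
    have hVP : (fun ω => V ω * (P ω - S)) =O[l] fun ω => e ω * ‖V ω‖ := by
      simpa only [mul_comm] using (isBigO_refl V l).norm_right.mul hP
    exact (hV.sub hVP).congr_left fun ω => by noncomm_ring
  have hVS : V =O[l] fun ω => V ω * S :=
    (isBigO_mul_const (isBigO_refl (fun ω => V ω * S) l) T).congr_left fun ω => by
      rw [mul_assoc, hST, mul_one]
  have hsmall : (fun ω => V ω * S - 1) =o[l] fun ω => V ω * S :=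
    hres.trans_isLittleO <| by
      simpa using ((isLittleO_one_iff ℝ).2 he).mul_isBigO hVS.norm_left.norm_right
  have hbdd : V =O[l] fun _ => (1 : ℝ) :=
    hVS.trans <| hsmall.right_isBigO_sub.trans <| by
      simpa using isBigO_const_const (1 : E) (one_ne_zero (α := ℝ)) l
  have hres' : (fun ω => V ω * S - 1) =O[l] e :=
    hres.trans <| by simpa using (isBigO_refl e l).mul hbdd.norm_left
  refine (isBigO_mul_const hres' T).congr_left fun ω => ?_
  rw [sub_mul, mul_assoc, hST, mul_one, one_mul]

end NormedRing

section LeAddBigO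

/-- `F ≤ G + O(g)` along the filter `l`, for functions with values in an ordered normed space. -/
def LeAddBigO {Ω E : Type*} [Norm E] [Add E] [LE E] (l : Filter Ω) (F G : Ω → E) (g : Ω → ℝ) :
    Prop :=
  ∃ R : Ω → E, R =O[l] g ∧ ∀ᶠ ω in l, F ω ≤ G ω + R ω

variable {Ω E : Type*} {l : Filter Ω}

section AddGroup

variable [NormedAddCommGroup E] [PartialOrder E] {F G H F' G' : Ω → E} {g : Ω → ℝ}

theorem LeAddBigO.of_le (h : ∀ ω, F ω ≤ G ω) : LeAddBigO l F G g :=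
  ⟨0, isBigO_zero g l, .of_forall fun ω => by simpa using h ω⟩

theorem LeAddBigO.of_sub_isBigO (h : (fun ω => F ω - G ω) =O[l] g) : LeAddBigO l F G g :=
  ⟨_, h, .of_forall fun ω => (add_sub_cancel (G ω) (F ω)).ge⟩

theorem LeAddBigO.smul [NormedSpace ℝ E] [PosSMulMono ℝ E] {e : Ω → ℝ} (he : ∀ ω, 0 ≤ e ω)
    (h : LeAddBigO l F G g) :
    LeAddBigO l (fun ω => e ω • F ω) (fun ω => e ω • G ω) (fun ω => e ω * g ω) := by
  obtain ⟨R, hR, h⟩ := h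
  refine ⟨fun ω => e ω • R ω, (isBigO_refl e l).smul hR, ?_⟩
  filter_upwards [h] with ω hω
  rw [← smul_add]
  exact smul_le_smul_of_nonneg_left hω (he ω)

variable [IsOrderedAddMonoid E]

theorem LeAddBigO.trans (hFG : LeAddBigO l F G g) (hGH : LeAddBigO l G H g) :
    LeAddBigO l F H g := by
  obtain ⟨R, hR, hFG⟩ := hFG
  obtain ⟨R', hR', hGH⟩ := hGH
  refine ⟨_, hR'.add hR, ?_⟩
  filter_upwards [hFG, hGH] with ω h h'
  calc F ω ≤ G ω + R ω := h
    _ ≤ H ω + R' ω + R ω := by gcongr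
    _ = H ω + (R' ω + R ω) := add_assoc _ _ _

theorem LeAddBigO.add (h : LeAddBigO l F G g) (h' : LeAddBigO l F' G' g) :
    LeAddBigO l (fun ω => F ω + F' ω) (fun ω => G ω + G' ω) g := by
  obtain ⟨R, hR, h⟩ := h
  obtain ⟨R', hR', h'⟩ := h'
  refine ⟨_, hR.add hR', ?_⟩
  filter_upwards [h, h'] with ω hω hω'
  calc F ω + F' ω ≤ G ω + R ω + (G' ω + R' ω) := add_le_add hω hω'
    _ = G ω + G' ω + (R ω + R' ω) := add_add_add_comm _ _ _ _

end AddGroup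

variable [NormedRing E] [PartialOrder E] [IsOrderedRing E] {F G : Ω → E} {g : Ω → ℝ} {c : E}

theorem LeAddBigO.mul_const (h : LeAddBigO l F G g) (hc : 0 ≤ c) :
    LeAddBigO l (fun ω => F ω * c) (fun ω => G ω * c) g := by
  obtain ⟨R, hR, h⟩ := h
  refine ⟨_, isBigO_mul_const hR c, ?_⟩
  filter_upwards [h] with ω hω
  rw [← add_mul]
  gcongr

theorem LeAddBigO.const_mul (h : LeAddBigO l F G g) (hc : 0 ≤ c) :
    LeAddBigO l (fun ω => c * F ω) (fun ω => c * G ω) g := by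
  obtain ⟨R, hR, h⟩ := h
  refine ⟨_, hR.const_mul_left c, ?_⟩
  filter_upwards [h] with ω hω
  rw [← mul_add]
  gcongr

end LeAddBigO

section FirstOrderError

variable {Ω : Type*} {l : Filter Ω} {n : ℕ} {e : Ω → ℝ}
  {F G F' G' H M M₀ P V : Ω → Matrix (Fin n) (Fin n) ℝ} {A A' S : Matrix (Fin n) (Fin n) ℝ}

/-- `F` approximates the matrix `A` up to an error with the first-order bound `G`:
`|F - A| ≤ e G + O(e²)` entrywise along `l`, with `G` bounded. The function `e` is the unit
roundoff, up to a factor. -/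
structure FirstOrderError (l : Filter Ω) (e : Ω → ℝ) (F : Ω → Matrix (Fin n) (Fin n) ℝ)
    (A : Matrix (Fin n) (Fin n) ℝ) (G : Ω → Matrix (Fin n) (Fin n) ℝ) : Prop where
  isBigO_one : G =O[l] fun _ => (1 : ℝ)
  le : LeAddBigO l (fun ω => absM (F ω - A)) (fun ω => e ω • G ω) (fun ω => e ω * e ω)

theorem isBigO_of_absM_le (h : ∀ᶠ ω in l, absM (F ω) ≤ G ω) : F =O[l] G :=
  .of_bound' (h.mono fun _ => norm_le_norm_of_absM_le)

theorem absM_isBigO (F : Ω → Matrix (Fin n) (Fin n) ℝ) : (fun ω => absM (F ω)) =O[l] F :=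
  .of_bound' (.of_forall fun _ => norm_absM.le)

theorem FirstOrderError.const (A : Matrix (Fin n) (Fin n) ℝ) :
    FirstOrderError l e (fun _ => A) A 0 :=
  ⟨isBigO_zero _ _, .of_le fun ω => by simp [absM]⟩

theorem FirstOrderError.congr (h : FirstOrderError l e F A G) (hG : ∀ ω, G ω = G' ω) :
    FirstOrderError l e F A G' :=
  funext hG ▸ h

theorem FirstOrderError.sub_isBigO (he : e =O[l] fun _ => (1 : ℝ))
    (h : FirstOrderError l e F A G) : (fun ω => F ω - A) =O[l] e := by
  obtain ⟨R, hR, hle⟩ := h.le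
  refine (isBigO_of_absM_le hle).trans (.add ?_ (hR.trans ?_))
  · simpa using (isBigO_refl e l).smul h.isBigO_one
  · simpa using he.mul (isBigO_refl e l)

theorem FirstOrderError.tendsto (he : Tendsto e l (𝓝 0)) (h : FirstOrderError l e F A G) :
    Tendsto F l (𝓝 A) :=
  tendsto_sub_nhds_zero_iff.1 ((h.sub_isBigO (he.isBigO_one ℝ)).trans_tendsto he)

theorem absM_sub_absM_isBigO (h : (fun ω => F ω - A) =O[l] e) :
    (fun ω => absM (F ω) - absM A) =O[l] e :=
  (isBigO_of_absM_le (.of_forall fun _ => absM_absM_sub_absM_le _ _)).trans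
    ((absM_isBigO _).trans h)

theorem isBigO_one_of_sub_isBigO (he : e =O[l] fun _ => (1 : ℝ))
    (h : (fun ω => F ω - A) =O[l] e) : F =O[l] fun _ => (1 : ℝ) := by
  simpa using (h.trans he).add (isBigO_const_const A one_ne_zero l)

theorem FirstOrderError.round (he : ∀ ω, 0 ≤ e ω) (h : FirstOrderError l e F A G)
    (hH : ∀ᶠ ω in l, absM (H ω - F ω) ≤ e ω • M ω) (hM₀ : M₀ =O[l] fun _ => (1 : ℝ))
    (hM : LeAddBigO l M M₀ e) : FirstOrderError l e H A (fun ω => G ω + M₀ ω) := by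
  refine ⟨h.isBigO_one.add hM₀, ?_⟩
  obtain ⟨R, hR, hle⟩ := h.le
  obtain ⟨R', hR', hle'⟩ := hM.smul he
  refine ⟨_, hR.add hR', ?_⟩
  filter_upwards [hle, hle', hH] with ω hω hω' hHω
  calc absM (H ω - A) = absM (F ω - A + (H ω - F ω)) := by congr 1; abel
    _ ≤ e ω • G ω + R ω + (e ω • M₀ ω + R' ω) :=
        (absM_add_le _ _).trans (add_le_add hω (hHω.trans hω'))
    _ = e ω • (G ω + M₀ ω) + (R ω + R' ω) := by rw [smul_add]; abel

theorem FirstOrderError.add (h : FirstOrderError l e F A G) (h' : FirstOrderError l e F' A' G') :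
    FirstOrderError l e (fun ω => F ω + F' ω) (A + A') (fun ω => G ω + G' ω) := by
  refine ⟨h.isBigO_one.add h'.isBigO_one, ?_⟩
  refine (LeAddBigO.of_le fun ω => ?_).trans ((h.le.add h'.le).trans (.of_le fun ω => ?_))
  · rw [add_sub_add_comm]
    exact absM_add_le _ _
  · rw [smul_add]

theorem FirstOrderError.mul (he : e =O[l] fun _ => (1 : ℝ)) (h : FirstOrderError l e F A G)
    (h' : FirstOrderError l e F' A' G') :
    FirstOrderError l e (fun ω => F ω * F' ω) (A * A')
      (fun ω => G ω * absM A' + absM A * G' ω) := by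
  refine ⟨(isBigO_mul_const h.isBigO_one _).add (h'.isBigO_one.const_mul_left _), ?_⟩
  have hprod := (absM_isBigO _).trans ((h.sub_isBigO he).mul (h'.sub_isBigO he))
  have hlin := (h.le.mul_const (absM_nonneg A')).add (h'.le.const_mul (absM_nonneg A))
  refine LeAddBigO.trans ?_ (hlin.trans (.of_le fun ω => ?_))
  · refine ⟨_, hprod, .of_forall fun ω => ?_⟩
    calc absM (F ω * F' ω - A * A')
        = absM ((F ω - A) * A' + A * (F' ω - A') + (F ω - A) * (F' ω - A')) := by
          congr 1; noncomm_ring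
      _ ≤ _ := (absM_add_le _ _).trans <| add_le_add_left ((absM_add_le _ _).trans
          (add_le_add (absM_mul_le _ _) (absM_mul_le _ _))) _
  · rw [smul_mul_assoc, mul_smul_comm, smul_add]

theorem FirstOrderError.mul_round (he0 : ∀ ω, 0 ≤ e ω) (he : e =O[l] fun _ => (1 : ℝ))
    (h : FirstOrderError l e F A G) (h' : FirstOrderError l e F' A' G')
    (hH : ∀ᶠ ω in l, absM (H ω - F ω * F' ω) ≤ e ω • (absM (F ω) * absM (F' ω)))
    (hM : M =O[l] fun _ => (1 : ℝ)) (hAM : LeAddBigO l (fun _ => absM A * absM A') M e) :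
    FirstOrderError l e H (A * A') (fun ω => G ω * absM A' + absM A * G' ω + M ω) := by
  refine (h.mul he h').round he0 hH hM (LeAddBigO.trans (.of_sub_isBigO ?_) hAM)
  have hF := absM_sub_absM_isBigO (h.sub_isBigO he)
  have hF' := absM_sub_absM_isBigO (h'.sub_isBigO he)
  have hF'1 := (absM_isBigO F').trans (isBigO_one_of_sub_isBigO he (h'.sub_isBigO he))
  have hmul := (hF.mul hF'1).congr_right fun ω => mul_one (e ω)
  exact (hmul.add (hF'.const_mul_left (absM A))).congr_left fun ω => by noncomm_ring

theorem FirstOrderError.add_round (he0 : ∀ ω, 0 ≤ e ω) (he : e =O[l] fun _ => (1 : ℝ))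
    (h : FirstOrderError l e F A G) (h' : FirstOrderError l e F' A' G')
    (hH : ∀ᶠ ω in l, absM (H ω - (F ω + F' ω)) ≤ e ω • absM (F ω + F' ω))
    (hM : M =O[l] fun _ => (1 : ℝ)) (hAM : LeAddBigO l (fun _ => absM (A + A')) M e) :
    FirstOrderError l e H (A + A') (fun ω => G ω + G' ω + M ω) :=
  (h.add h').round he0 hH hM <|
    .trans (.of_sub_isBigO (absM_sub_absM_isBigO ((h.add h').sub_isBigO he))) hAM

theorem absM_sub_le_of_mul_eq_one {V P S T : Matrix (Fin n) (Fin n) ℝ} (hST : S * T = 1) :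
    absM (V - T) ≤ (absM (V * P - 1) + absM V * absM (P - S)) * absM T :=
  calc absM (V - T) = absM ((V * P - 1 - V * (P - S)) * T) := by
        rw [show V * P - 1 - V * (P - S) = V * S - 1 by noncomm_ring, sub_mul, mul_assoc, hST,
          mul_one, one_mul]
    _ ≤ (absM (V * P - 1) + absM V * absM (P - S)) * absM T := by
        refine (absM_mul_le _ _).trans (mul_le_mul_of_nonneg_right ?_ (absM_nonneg T))
        exact (absM_sub_le _ _).trans (add_le_add_right (absM_mul_le _ _) _)

theorem FirstOrderError.inv (he : Tendsto e l (𝓝 0)) (hS : IsUnit S)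
    (hP : FirstOrderError l e P S G) (hM : M =O[l] fun _ => (1 : ℝ))
    (hV : ∀ᶠ ω in l, absM (V ω * P ω - 1) ≤ e ω • (absM (V ω) * M ω)) :
    FirstOrderError l e V S⁻¹ (fun ω => absM S⁻¹ * (M ω + G ω) * absM S⁻¹) := by
  have he1 : e =O[l] fun _ => (1 : ℝ) := he.isBigO_one ℝ
  have hST : S * S⁻¹ = 1 := Matrix.mul_nonsing_inv _ ((Matrix.isUnit_iff_isUnit_det S).1 hS)
  have hres : (fun ω => V ω * P ω - 1) =O[l] fun ω => e ω * ‖V ω‖ := by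
    simpa using (isBigO_of_absM_le hV).trans
      ((isBigO_refl e l).smul ((absM_isBigO V).norm_right.mul hM))
  have hsub := sub_isBigO_of_mul_sub_one_isBigO he hST (hP.sub_isBigO he1) hres
  have hMG : (fun ω => e ω • (M ω + G ω)) =O[l] e := by
    simpa using (isBigO_refl e l).smul (hM.add hP.isBigO_one)
  obtain ⟨R, hR, hle⟩ := hP.le
  have hVR : (fun ω => absM (V ω) * R ω) =O[l] fun ω => e ω * e ω := by
    simpa using ((absM_isBigO V).trans (isBigO_one_of_sub_isBigO he1 hsub)).mul hR
  refine ⟨isBigO_mul_const ((hM.add hP.isBigO_one).const_mul_left _) _,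
    _, isBigO_mul_const (((absM_sub_absM_isBigO hsub).mul hMG).add hVR) (absM S⁻¹), ?_⟩
  filter_upwards [hV, hle] with ω hω hω'
  have hT := absM_nonneg S⁻¹
  have hVnonneg := absM_nonneg (V ω)
  calc absM (V ω - S⁻¹)
      ≤ (absM (V ω * P ω - 1) + absM (V ω) * absM (P ω - S)) * absM S⁻¹ :=
        absM_sub_le_of_mul_eq_one hST
    _ ≤ (e ω • (absM (V ω) * M ω) + absM (V ω) * (e ω • G ω + R ω)) * absM S⁻¹ := by gcongr
    _ = _ := by
        simp only [add_mul, sub_mul, mul_add, mul_smul_comm, smul_mul_assoc, mul_assoc]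
        module

theorem absM_inv_le_addBigO {L U : Ω → Matrix (Fin n) (Fin n) ℝ} (hA : IsUnit A)
    (h : (fun ω => L ω * U ω - A) =O[l] e) :
    LeAddBigO l (fun _ => absM A⁻¹)
      (fun ω => absM A⁻¹ * (absM (L ω) * absM (U ω)) * absM A⁻¹) e := by
  refine ⟨_, isBigO_mul_const (((absM_isBigO _).trans h).const_mul_left (absM A⁻¹)) (absM A⁻¹),
    .of_forall fun ω => ?_⟩
  have hinv := absM_nonneg A⁻¹
  have hAinv : A⁻¹ * A = 1 := Matrix.nonsing_inv_mul _ ((Matrix.isUnit_iff_isUnit_det A).1 hA)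
  calc absM A⁻¹ = absM (A⁻¹ * (L ω * U ω - (L ω * U ω - A)) * A⁻¹) := by
        rw [sub_sub_cancel, hAinv, one_mul]
    _ ≤ absM A⁻¹ * (absM (L ω) * absM (U ω) + absM (L ω * U ω - A)) * absM A⁻¹ := by
        refine (absM_mul_le _ _).trans ?_
        gcongr
        refine (absM_mul_le _ _).trans ?_
        gcongr
        exact (absM_sub_le _ _).trans (add_le_add_left (absM_mul_le _ _) _)
    _ = _ := by rw [mul_add, add_mul]

theorem exists_forall_apply_le_add_mul_sq {u : Ω → ℝ} (hu0 : ∀ ω, 0 ≤ u ω)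
    (h : LeAddBigO (comap u (𝓝 0)) F G fun ω => u ω ^ 2) :
    ∃ u₀ κ : ℝ, 0 < u₀ ∧ 0 ≤ κ ∧
      ∀ ω, u ω ≤ u₀ → ∀ i j, F ω i j ≤ G ω i j + κ * u ω ^ 2 := by
  obtain ⟨R, hR, hle⟩ := h
  obtain ⟨κ, hκ, hRκ⟩ := hR.exists_nonneg
  obtain ⟨u₀, hu₀, hball⟩ :=
    ((Metric.nhds_basis_closedBall).comap u).eventually_iff.1 (hle.and hRκ.bound)
  refine ⟨u₀, κ, hu₀, hκ, fun ω hω i j => ?_⟩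
  obtain ⟨hFG, hRω⟩ := hball (show ω ∈ u ⁻¹' Metric.closedBall 0 u₀ by
    simpa [abs_of_nonneg (hu0 ω)] using hω)
  rw [Real.norm_of_nonneg (sq_nonneg (u ω))] at hRω
  calc F ω i j ≤ G ω i j + R ω i j := hFG i j
    _ ≤ G ω i j + κ * u ω ^ 2 := by
        gcongr
        exact (le_abs_self _).trans ((abs_apply_le_norm i j).trans hRω)

end FirstOrderError

section Run

/-- A run of the real part of Frobenius inversion, which computes `J = (X + Y X⁻¹ Y)⁻¹` and
`K = X⁻¹ Y J`, with all its intermediate results. -/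
structure Run {n : ℕ} (X Y : Matrix (Fin n) (Fin n) ℝ) where
  u : ℝ
  (LX UX V H₁ H₂ P LP UP J K : Matrix (Fin n) (Fin n) ℝ)
  u_nonneg : 0 ≤ u
  inv_X : FlInverse u X LX UX V
  mul_H₁ : FlMatMul u V Y H₁
  mul_H₂ : FlMatMul u Y H₁ H₂
  add_P : FlMatAdd u X H₂ P
  inv_P : FlInverse u P LP UP J
  mul_K : FlMatMul u H₁ J K

variable {n : ℕ} {X Y : Matrix (Fin n) (Fin n) ℝ}

/-- The filter of vanishing unit roundoff, along which the first-order error bounds hold. -/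
def Run.limit (X Y : Matrix (Fin n) (Fin n) ℝ) : Filter (Run X Y) := comap Run.u (𝓝 0)

/-- The factor `8 n u` of the residual bounds of all the matrix operations. -/
def Run.eps (r : Run X Y) : ℝ := 8 * (n * r.u)

/-- `|X⁻¹||L_X||U_X||X⁻¹|`, which bounds the error of the computed `X⁻¹`, up to a factor. -/
noncomputable def Run.boundX (r : Run X Y) : Matrix (Fin n) (Fin n) ℝ :=
  absM X⁻¹ * (absM r.LX * absM r.UX) * absM X⁻¹

/-- The first-order bound for the error of the computed `J`. -/
noncomputable def Run.boundJ (r : Run X Y) : Matrix (Fin n) (Fin n) ℝ :=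
  absM (exactJ X Y) *
    (4 • (absM r.LP * absM r.UP) + (absM X + 7 • (absM Y * (r.boundX * absM Y)))) *
      absM (exactJ X Y)

theorem Run.eps_nonneg (r : Run X Y) : 0 ≤ r.eps := by
  have := r.u_nonneg
  unfold Run.eps
  positivity

theorem Run.tendsto_u : Tendsto Run.u (Run.limit X Y) (𝓝 0) := tendsto_comap

theorem Run.tendsto_eps : Tendsto Run.eps (Run.limit X Y) (𝓝 0) := by
  change Tendsto (fun r : Run X Y => 8 * (n * r.u)) (Run.limit X Y) (𝓝 0)
  simpa only [mul_zero] using (Run.tendsto_u.const_mul (n : ℝ)).const_mul 8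

theorem Run.eventually_mul_u_le_one : ∀ᶠ r in Run.limit X Y, 16 * (n * r.u) ≤ (1 : ℝ) := by
  simpa only [mul_assoc] using eventually_mul_le_one Run.tendsto_u (16 * n)

theorem Run.isBigO_one_of_flLU {A L U : Run X Y → Matrix (Fin n) (Fin n) ℝ}
    {A₀ : Matrix (Fin n) (Fin n) ℝ} (hunit : IsUnit A₀) (hLU : HasLU A₀)
    (hA : Tendsto A (Run.limit X Y) (𝓝 A₀)) (h : ∀ r : Run X Y, FlLU r.u (A r) (L r) (U r)) :
    (fun r => absM (L r) * absM (U r)) =O[Run.limit X Y] fun _ => (1 : ℝ) := by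
  obtain ⟨L₀, U₀, hL₀, hU₀, rfl⟩ := hLU
  obtain ⟨hL, hU⟩ := tendsto_of_flLU Run.u_nonneg Run.tendsto_u hL₀ hU₀ hunit hA h
  simpa using ((absM_isBigO L).trans (hL.isBigO_one ℝ)).mul
    ((absM_isBigO U).trans (hU.isBigO_one ℝ))

theorem Run.firstOrderError_mul {F F' H G G' M : Run X Y → Matrix (Fin n) (Fin n) ℝ}
    {A A' : Matrix (Fin n) (Fin n) ℝ} (h : FirstOrderError (Run.limit X Y) Run.eps F A G)
    (h' : FirstOrderError (Run.limit X Y) Run.eps F' A' G')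
    (hH : ∀ r : Run X Y, FlMatMul r.u (F r) (F' r) (H r))
    (hM : M =O[Run.limit X Y] fun _ => (1 : ℝ))
    (hAM : LeAddBigO (Run.limit X Y) (fun _ => absM A * absM A') M Run.eps) :
    FirstOrderError (Run.limit X Y) Run.eps H (A * A')
      fun r => G r * absM A' + absM A * G' r + M r :=
  h.mul_round Run.eps_nonneg (Run.tendsto_eps.isBigO_one ℝ) h'
    (Run.eventually_mul_u_le_one.mono fun r hr => (hH r).absM_sub_le r.u_nonneg hr) hM hAM

theorem Run.firstOrderError_inv {F L U V G : Run X Y → Matrix (Fin n) (Fin n) ℝ}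
    {A : Matrix (Fin n) (Fin n) ℝ} (hA : IsUnit A) (hLU : HasLU A)
    (h : FirstOrderError (Run.limit X Y) Run.eps F A G)
    (hV : ∀ r : Run X Y, FlInverse r.u (F r) (L r) (U r) (V r)) :
    FirstOrderError (Run.limit X Y) Run.eps V A⁻¹
      fun r => absM A⁻¹ * (4 • (absM (L r) * absM (U r)) + G r) * absM A⁻¹ :=
  have hLUbdd := Run.isBigO_one_of_flLU hA hLU (h.tendsto Run.tendsto_eps) fun r => (hV r).1
  h.inv Run.tendsto_eps hA (by simpa only [nsmul_eq_mul] using hLUbdd.const_mul_left _)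
    (Run.eventually_mul_u_le_one.mono fun r hr => (hV r).absM_mul_sub_one_le r.u_nonneg hr)

theorem Run.isBigO_absM_mul_absM (hX : IsUnit X) (hXLU : HasLU X) :
    (fun r : Run X Y => absM r.LX * absM r.UX) =O[Run.limit X Y] fun _ => (1 : ℝ) :=
  Run.isBigO_one_of_flLU hX hXLU tendsto_const_nhds fun r => r.inv_X.1

theorem Run.boundX_isBigO_one (hX : IsUnit X) (hXLU : HasLU X) :
    Run.boundX =O[Run.limit X Y] fun _ => (1 : ℝ) :=
  isBigO_mul_const ((Run.isBigO_absM_mul_absM hX hXLU).const_mul_left _) _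

theorem Run.absM_inv_le_boundX (hX : IsUnit X) (hXLU : HasLU X) :
    LeAddBigO (Run.limit X Y) (fun _ => absM X⁻¹) Run.boundX Run.eps := by
  refine absM_inv_le_addBigO hX ((isBigO_of_absM_le ?_).trans
    (((isBigO_refl Run.eps _).smul (Run.isBigO_absM_mul_absM hX hXLU)).congr_right fun r => ?_))
  · exact Run.eventually_mul_u_le_one.mono fun r hr => r.inv_X.1.absM_mul_sub_le r.u_nonneg hr
  · rw [smul_eq_mul, mul_one]

theorem Run.absM_inv_mul_le_boundX_mul (hX : IsUnit X) (hXLU : HasLU X) :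
    LeAddBigO (Run.limit X Y) (fun _ => absM (X⁻¹ * Y)) (fun r => r.boundX * absM Y) Run.eps :=
  .trans (.of_le fun _ => absM_mul_le _ _)
    ((Run.absM_inv_le_boundX hX hXLU).mul_const (absM_nonneg Y))

theorem Run.firstOrderError_V (hX : IsUnit X) (hXLU : HasLU X) :
    FirstOrderError (Run.limit X Y) Run.eps Run.V X⁻¹ fun r => 4 • r.boundX :=
  (Run.firstOrderError_inv hX hXLU (.const X) Run.inv_X).congr fun r => by
    rw [Pi.zero_apply, add_zero, mul_smul_comm, smul_mul_assoc, Run.boundX]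

theorem Run.firstOrderError_H₁ (hX : IsUnit X) (hXLU : HasLU X) :
    FirstOrderError (Run.limit X Y) Run.eps Run.H₁ (X⁻¹ * Y)
      fun r => 5 • (r.boundX * absM Y) :=
  (Run.firstOrderError_mul (Run.firstOrderError_V hX hXLU) (.const Y) Run.mul_H₁
    (isBigO_mul_const (Run.boundX_isBigO_one hX hXLU) (absM Y))
    ((Run.absM_inv_le_boundX hX hXLU).mul_const (absM_nonneg Y))).congr fun r => by
      rw [Pi.zero_apply, mul_zero, smul_mul_assoc]
      module

theorem Run.firstOrderError_H₂ (hX : IsUnit X) (hXLU : HasLU X) :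
    FirstOrderError (Run.limit X Y) Run.eps Run.H₂ (Y * (X⁻¹ * Y))
      fun r => 6 • (absM Y * (r.boundX * absM Y)) :=
  (Run.firstOrderError_mul (.const Y) (Run.firstOrderError_H₁ hX hXLU) Run.mul_H₂
    ((isBigO_mul_const (Run.boundX_isBigO_one hX hXLU) (absM Y)).const_mul_left (absM Y))
    ((Run.absM_inv_mul_le_boundX_mul hX hXLU).const_mul (absM_nonneg Y))).congr fun r => by
      rw [Pi.zero_apply, zero_mul, mul_smul_comm]
      module

theorem Run.firstOrderError_P (hX : IsUnit X) (hXLU : HasLU X) :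
    FirstOrderError (Run.limit X Y) Run.eps Run.P (X + Y * X⁻¹ * Y)
      fun r => absM X + 7 • (absM Y * (r.boundX * absM Y)) := by
  have hbdd := (isBigO_mul_const (Run.boundX_isBigO_one (Y := Y) hX hXLU) (absM Y)).const_mul_left
    (absM Y)
  have hle := (Run.absM_inv_mul_le_boundX_mul (Y := Y) hX hXLU).const_mul (absM_nonneg Y)
  rw [mul_assoc]
  refine ((FirstOrderError.const X).add_round Run.eps_nonneg (Run.tendsto_eps.isBigO_one ℝ)
    (Run.firstOrderError_H₂ hX hXLU) (.of_forall fun r => r.add_P.absM_sub_le r.u_nonneg)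
    ((isBigO_const_const (absM X) one_ne_zero _).add hbdd) ?_).congr fun r => ?_
  · refine .trans (.of_le fun _ => ?_) ((LeAddBigO.of_le fun _ => le_rfl).add hle)
    exact (absM_add_le _ _).trans (add_le_add_right (absM_mul_le _ _) _)
  · rw [Pi.zero_apply]
    module

theorem Run.firstOrderError_J (hX : IsUnit X) (hXLU : HasLU X)
    (hS : IsUnit (X + Y * X⁻¹ * Y)) (hSLU : HasLU (X + Y * X⁻¹ * Y)) :
    FirstOrderError (Run.limit X Y) Run.eps Run.J (exactJ X Y) Run.boundJ :=
  Run.firstOrderError_inv hS hSLU (Run.firstOrderError_P hX hXLU) Run.inv_P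

theorem Run.firstOrderError_K (hX : IsUnit X) (hXLU : HasLU X)
    (hS : IsUnit (X + Y * X⁻¹ * Y)) (hSLU : HasLU (X + Y * X⁻¹ * Y)) :
    FirstOrderError (Run.limit X Y) Run.eps Run.K (X⁻¹ * Y * exactJ X Y) fun r =>
      6 • (r.boundX * absM Y * absM (exactJ X Y)) + absM (X⁻¹ * Y) * r.boundJ :=
  (Run.firstOrderError_mul (Run.firstOrderError_H₁ hX hXLU)
    (Run.firstOrderError_J hX hXLU hS hSLU) Run.mul_K
    (isBigO_mul_const (isBigO_mul_const (Run.boundX_isBigO_one hX hXLU) (absM Y)) _)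
    ((Run.absM_inv_mul_le_boundX_mul hX hXLU).mul_const (absM_nonneg _))).congr fun r => by
      rw [smul_mul_assoc]
      module

theorem Run.boundJ_add_le_errorBound (r : Run X Y) :
    r.boundJ + (6 • (r.boundX * absM Y * absM (exactJ X Y)) + absM (X⁻¹ * Y) * r.boundJ) ≤
      7 • errorBound X Y r.LX r.UX r.LP r.UP := by
  have hX := absM_nonneg X
  have hXinv := absM_nonneg X⁻¹
  have hXY := absM_nonneg (X⁻¹ * Y)
  have hY := absM_nonneg Y
  have hJ := absM_nonneg (exactJ X Y)
  have hLX := absM_nonneg r.LX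
  have hUX := absM_nonneg r.UX
  have hLP := absM_nonneg r.LP
  have hUP := absM_nonneg r.UP
  have hB : 0 ≤ r.boundX := by
    unfold Run.boundX
    positivity
  set Q := absM X + absM Y * (r.boundX * absM Y) + absM r.LP * absM r.UP with hQ
  have hbound : errorBound X Y r.LX r.UX r.LP r.UP =
      r.boundX * absM Y * absM (exactJ X Y) +
        (absM (X⁻¹ * Y) + 1) * (absM (exactJ X Y) * Q * absM (exactJ X Y)) := by
    simp only [errorBound, hQ, Run.boundX, mul_assoc]
  have hboundJ : r.boundJ ≤ 7 • (absM (exactJ X Y) * Q * absM (exactJ X Y)) :=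
    calc r.boundJ ≤ absM (exactJ X Y) * (7 • (absM r.LP * absM r.UP) +
          (7 • absM X + 7 • (absM Y * (r.boundX * absM Y)))) * absM (exactJ X Y) := by
          unfold Run.boundJ
          gcongr
          · norm_num
          · exact le_smul_of_one_le_left hX (by norm_num)
      _ = 7 • (absM (exactJ X Y) * Q * absM (exactJ X Y)) := by
          simp only [hQ, mul_add, add_mul, mul_smul_comm, smul_mul_assoc]
          module
  rw [hbound]
  calc r.boundJ + (6 • (r.boundX * absM Y * absM (exactJ X Y)) + absM (X⁻¹ * Y) * r.boundJ)
      ≤ 7 • (absM (exactJ X Y) * Q * absM (exactJ X Y)) +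
        (7 • (r.boundX * absM Y * absM (exactJ X Y)) +
          absM (X⁻¹ * Y) * 7 • (absM (exactJ X Y) * Q * absM (exactJ X Y))) := by
        gcongr
        norm_num
    _ = _ := by
        rw [add_mul, one_mul, mul_smul_comm]
        module

theorem Run.exists_bound (hX : IsUnit X) (hXLU : HasLU X)
    (hS : IsUnit (X + Y * X⁻¹ * Y)) (hSLU : HasLU (X + Y * X⁻¹ * Y)) :
    ∃ u₀ κ : ℝ, 0 < u₀ ∧ 0 ≤ κ ∧ ∀ r : Run X Y, r.u ≤ u₀ → ∀ i j,
      (absM (r.J - exactJ X Y) + absM (r.K - X⁻¹ * Y * exactJ X Y)) i j ≤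
        56 * n * errorBound X Y r.LX r.UX r.LP r.UP i j * r.u + κ * r.u ^ 2 := by
  have hJ := Run.firstOrderError_J hX hXLU hS hSLU
  have hK := Run.firstOrderError_K hX hXLU hS hSLU
  have heps : (fun r : Run X Y => r.eps * r.eps) =O[Run.limit X Y] fun r => r.u ^ 2 :=
    ((isBigO_refl (fun r : Run X Y => r.u ^ 2) _).const_mul_left ((8 * n) ^ 2)).congr_left
      fun r => by rw [Run.eps]; ring
  obtain ⟨R, hR, hle⟩ := (hJ.le.add hK.le).trans <|
    .of_le (G := fun r => r.eps • (7 • errorBound X Y r.LX r.UX r.LP r.UP)) fun r => by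
      rw [← smul_add]
      exact smul_le_smul_of_nonneg_left r.boundJ_add_le_errorBound r.eps_nonneg
  obtain ⟨u₀, κ, hu₀, hκ, hbound⟩ :=
    exists_forall_apply_le_add_mul_sq Run.u_nonneg ⟨R, hR.trans heps, hle⟩
  refine ⟨u₀, κ, hu₀, hκ, fun r hr i j => (hbound r hr i j).trans_eq ?_⟩
  rw [Matrix.smul_apply, Matrix.smul_apply, smul_eq_mul, nsmul_eq_mul, Run.eps]
  push_cast
  ring

end Run

section Complex

variable {n : ℕ}

theorem complexOf_rePart_imPart (Z : Matrix (Fin n) (Fin n) ℂ) :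
    complexOf (rePart Z) (imPart Z) = Z := by
  ext i j
  simp [complexOf, rePart, imPart, mul_comm Complex.I]

theorem complexOf_mul (A B C D : Matrix (Fin n) (Fin n) ℝ) :
    complexOf A B * complexOf C D = complexOf (A * C - B * D) (A * D + B * C) := by
  ext i j
  apply Complex.ext <;>
    simp [complexOf, Matrix.mul_apply, Finset.sum_add_distrib, Finset.sum_sub_distrib]

theorem complexOf_one_zero : complexOf (1 : Matrix (Fin n) (Fin n) ℝ) 0 = 1 := by
  ext i j
  by_cases h : i = j <;> simp [complexOf, Matrix.one_apply, h]

theorem norm_complexOf_sub_le (A B C D : Matrix (Fin n) (Fin n) ℝ) (i j : Fin n) :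
    ‖(complexOf A B - complexOf C D) i j‖ ≤ (absM (C - A) + absM (D - B)) i j := by
  refine (Complex.norm_le_abs_re_add_abs_im _).trans_eq ?_
  simp [complexOf, absM, abs_sub_comm]

theorem Branch.isUnit_of_mem_domain {b : Branch} {Z : Matrix (Fin n) (Fin n) ℂ}
    (hZ : Z ∈ b.domain n) :
    IsUnit (b.X Z) ∧ IsUnit (b.X Z + b.Y Z * (b.X Z)⁻¹ * b.Y Z) := by
  cases b <;> exact hZ.2

theorem Branch.inv_eq_output (b : Branch) {Z : Matrix (Fin n) (Fin n) ℂ}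
    (hX : IsUnit (b.X Z)) (hS : IsUnit (b.X Z + b.Y Z * (b.X Z)⁻¹ * b.Y Z)) :
    Z⁻¹ = b.output (exactJ (b.X Z) (b.Y Z)) ((b.X Z)⁻¹ * b.Y Z * exactJ (b.X Z) (b.Y Z)) := by
  rw [Matrix.isUnit_iff_isUnit_det] at hX hS
  set X := b.X Z
  set Y := b.Y Z
  have hone : X * exactJ X Y + Y * (X⁻¹ * Y * exactJ X Y) = 1 := by
    rw [← Matrix.mul_nonsing_inv _ hS, exactJ, add_mul]
    simp only [mul_assoc]
  have hcancel : X * (X⁻¹ * Y * exactJ X Y) = Y * exactJ X Y := by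
    rw [mul_assoc, Matrix.mul_nonsing_inv_cancel_left _ _ hX]
  refine Matrix.inv_eq_right_inv ?_
  conv_lhs => rw [← complexOf_rePart_imPart Z]
  rw [← complexOf_one_zero]
  cases b
  · change complexOf X Y * complexOf _ _ = _
    rw [complexOf_mul, mul_neg, mul_neg, sub_neg_eq_add, hone, hcancel, neg_add_cancel]
  · change complexOf Y X * complexOf _ _ = _
    rw [complexOf_mul, mul_neg, mul_neg, sub_neg_eq_add, hcancel, add_comm, hone, neg_add_cancel]

theorem Branch.norm_output_sub_le (b : Branch) (J K J' K' : Matrix (Fin n) (Fin n) ℝ)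
    (i j : Fin n) :
    ‖(b.output J K - b.output J' K') i j‖ ≤ (absM (J' - J) + absM (K' - K)) i j := by
  cases b
  · refine (norm_complexOf_sub_le _ _ _ _ i j).trans_eq ?_
    rw [← neg_sub', absM_neg]
  · refine (norm_complexOf_sub_le _ _ _ _ i j).trans_eq ?_
    rw [← neg_sub', absM_neg, add_comm]

end Complex

end FrobeniusInversion

theorem mainTheorem8 :
    ∃ C : ℝ, 0 < C ∧
      ∀ (n : ℕ) (b : FrobeniusInversion.Branch) (Z : Matrix (Fin n) (Fin n) ℂ),
        Z ∈ b.domain n →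
        FrobeniusInversion.HasLU (b.X Z) →
        FrobeniusInversion.HasLU (b.X Z + b.Y Z * (b.X Z)⁻¹ * b.Y Z) →
        ∃ u₀ κ : ℝ, 0 < u₀ ∧ 0 ≤ κ ∧
          ∀ u : ℝ, 0 < u → u ≤ u₀ →
            ∀ (LX UX P LP UP : Matrix (Fin n) (Fin n) ℝ) (W : Matrix (Fin n) (Fin n) ℂ),
              FrobeniusInversion.FlFrobenius u b Z LX UX P LP UP W →
              ∀ i j : Fin n,
                ‖(Z⁻¹ - W) i j‖ ≤
                  C * n * FrobeniusInversion.errorBound (b.X Z) (b.Y Z) LX UX LP UP i j * u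
                    + κ * u ^ 2 := by
  refine ⟨56, by norm_num, fun n b Z hZ hXLU hSLU => ?_⟩
  obtain ⟨hX, hS⟩ := FrobeniusInversion.Branch.isUnit_of_mem_domain hZ
  obtain ⟨u₀, κ, hu₀, hκ, hbound⟩ :=
    FrobeniusInversion.Run.exists_bound (Y := b.Y Z) hX hXLU hS hSLU
  refine ⟨u₀, κ, hu₀, hκ, ?_⟩
  rintro u hu huu₀ LX UX P LP UP _
    ⟨V, H₁, H₂, J, K, inv_X, mul_H₁, mul_H₂, add_P, inv_P, mul_K, rfl⟩ i j
  rw [b.inv_eq_output hX hS]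
  exact (b.norm_output_sub_le _ _ _ _ i j).trans <| hbound
    { u, LX, UX, V, H₁, H₂, P, LP, UP, J, K, u_nonneg := hu.le
      inv_X, mul_H₁, mul_H₂, add_P, inv_P, mul_K } huu₀ i j
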